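/- Let $p\ge 1$ and let $\{a_n\}_{n\ge 1}$, $\{b_n\}_{n\ge 1}$ be real sequences with $a_n>0$, $a_{n+p}=a_n$ and $b_{n+p}=b_n$ for all $n\ge 1$. Define polynomials $p_n$ by $p_{-1}=0$, $p_0=1$ and $$x\,p_n(x)=a_{n+1}p_{n+1}(x)+b_{n+1}p_n(x)+a_np_{n-1}(x)\qquad(n\ge 0),$$ where the last term is read as $0$ for $n=0$, and let $\mu$ be the spectral measure of these Jacobi parameters, that is, the probability measure on $\mathbb{R}$ for which the $p_n$ are orthonormal: $\int p_m p_n\,d\mu=\delta_{mn}$ for all $m,n\ge 0$. Let $z_0\in\mathbb{C}$. Then $z_0$ is a limit of zeros of $p_n$ (all $n$), meaning that there are $z_n\in\mathbb{C}$ for $n\ge 1$ with $p_n(z_n)=0$ and $z_n\to z_0$, if and only if $z_0\in\operatorname{supp}(\mu)\subset\mathbb{R}\subset\mathbb{C}$. -/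

import Mathlib

open Filter Topology MeasureTheory

/-- The polynomials `p_n` attached to Jacobi parameters `a_1, a_2, …` and `b_1, b_2, …` (the values
`a 0` and `b 0` play no role): `p_{-1} = 0`, `p_0 = 1` and
`x p_n(x) = a_{n+1} p_{n+1}(x) + b_{n+1} p_n(x) + a_n p_{n-1}(x)` for `n ≥ 0`,
solved for `p_{n+1}`. -/
noncomputable def jacobiPoly (a b : ℕ → ℝ) : ℕ → Polynomial ℝ
  | 0 => 1
  | 1 => Polynomial.C (a 1)⁻¹ * (Polynomial.X - Polynomial.C (b 1))
  | n + 2 => Polynomial.C (a (n + 2))⁻¹ *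
      ((Polynomial.X - Polynomial.C (b (n + 2))) * jacobiPoly a b (n + 1)
        - Polynomial.C (a (n + 1)) * jacobiPoly a b n)

/-- `μ` is a spectral measure of the Jacobi parameters: a probability measure on `ℝ` for which the
`p_n` are the orthonormal polynomials. (For bounded parameters there is exactly one.) -/
structure IsSpectralMeasure (a b : ℕ → ℝ) (μ : Measure ℝ) : Prop where
  isProbabilityMeasure : IsProbabilityMeasure μ
  integrable : ∀ m n : ℕ,
    Integrable (fun x => (jacobiPoly a b m).eval x * (jacobiPoly a b n).eval x) μ
  orthonormal : ∀ m n : ℕ,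
    ∫ x, (jacobiPoly a b m).eval x * (jacobiPoly a b n).eval x ∂μ = if m = n then 1 else 0

/-- `z₀` is a limit of zeros of `p_n` (all `n`): there are complex zeros `z_n` of `p_n`, one for
each `n ≥ 1` (the constant `p_0 = 1` has none), with `z_n → z₀`. -/
def IsLimitOfZeros (P : ℕ → Polynomial ℝ) (z₀ : ℂ) : Prop :=
  ∃ z : ℕ → ℂ, (∀ n, 1 ≤ n → Polynomial.aeval (z n) (P n) = 0) ∧ Tendsto z atTop (𝓝 z₀)

/-!
Only the boundedness of the Jacobi parameters is used; periodicity enters through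
`exists_abs_le_of_periodic`. Everything rests on the Christoffel–Darboux identity
(`christoffel_darboux`)
`(z - w) ∑_{k ≤ n} p_k(z) p_k(w) = a_{n+1} (p_{n+1}(z) p_n(w) - p_n(z) p_{n+1}(w))`,
which shows at once that the zeros of `p_n` are real and simple.

*A limit of zeros lies in the support.* Suppose that a zero `y` of `p_n` and a zero `w` of
`p_{n+1}` both have distance at least `d` from almost every point, and write `K` for
`∑_{k ≤ n} p_k²`. Integrating the square of the identity against `μ` gives
`d² K(y) ≤ a_{n+1}² p_{n+1}(y)²` and `d² K(w) ≤ a_{n+1}² p_n(w)²`. On the other hand the identity at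
`(y, w)` and the Cauchy–Schwarz inequality give
`a_{n+1}² p_n(w)² p_{n+1}(y)² ≤ (y - w)² K(y) K(w)`. Hence `d² ≤ |y - w| a_{n+1}`
(`IsSpectralMeasure.sq_le_abs_sub_mul`): away from the support, zeros of consecutive polynomials
stay apart, so they cannot have a common limit there.

*A point `x₀` of the support is a limit of zeros.* Gauss quadrature
(`IsSpectralMeasure.eventually_integral_eq_sum_roots`) writes the integral of a fixed polynomial,
for large `n`, as a positive combination of its values at the zeros of `p_n`. As these zeros are
bounded, `μ` has bounded support, and by Weierstrass approximation there is a polynomial `q` with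
`∫ (ε² - (x - x₀)²) q(x)² dμ > 0`. By quadrature the integrand is positive at a zero of `p_n`, which
then lies within `ε` of `x₀` (`IsSpectralMeasure.eventually_exists_root`).
-/

open Polynomial

/-! ### Christoffel–Darboux identity and the zeros of the orthogonal polynomials -/

section JacobiPoly

variable {a b : ℕ → ℝ}

lemma X_mul_jacobiPoly_zero (ha : ∀ n, 1 ≤ n → 0 < a n) :
    X * jacobiPoly a b 0 = C (a 1) * jacobiPoly a b 1 + C (b 1) * jacobiPoly a b 0 := by
  have h : C (a 1) * C (a 1)⁻¹ = (1 : ℝ[X]) := by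
    rw [← C_mul, mul_inv_cancel₀ (ha 1 le_rfl).ne', C_1]
  simp only [jacobiPoly]
  linear_combination (C (b 1) - X) * h

lemma X_mul_jacobiPoly_succ (ha : ∀ n, 1 ≤ n → 0 < a n) (n : ℕ) :
    X * jacobiPoly a b (n + 1) = C (a (n + 2)) * jacobiPoly a b (n + 2)
      + C (b (n + 2)) * jacobiPoly a b (n + 1) + C (a (n + 1)) * jacobiPoly a b n := by
  have h : C (a (n + 2)) * C (a (n + 2))⁻¹ = (1 : ℝ[X]) := by
    rw [← C_mul, mul_inv_cancel₀ (ha (n + 2) (by omega)).ne', C_1]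
  rw [jacobiPoly]
  linear_combination (-((X - C (b (n + 2))) * jacobiPoly a b (n + 1)
        - C (a (n + 1)) * jacobiPoly a b n)) * h

/-- The Christoffel–Darboux identity, over an arbitrary commutative `ℝ`-algebra: it is used over
`ℝ`, over `ℂ` (zeros are real) and over `ℝ[X]` (zeros are simple). -/
theorem christoffel_darboux (ha : ∀ n, 1 ≤ n → 0 < a n) {R : Type*} [CommRing R] [Algebra ℝ R]
    (z w : R) (n : ℕ) :
    (z - w) * ∑ k ∈ Finset.range (n + 1),
        aeval z (jacobiPoly a b k) * aeval w (jacobiPoly a b k) =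
      algebraMap ℝ R (a (n + 1)) *
        (aeval z (jacobiPoly a b (n + 1)) * aeval w (jacobiPoly a b n)
          - aeval z (jacobiPoly a b n) * aeval w (jacobiPoly a b (n + 1))) := by
  induction n with
  | zero =>
    have hz := congrArg (aeval z) (X_mul_jacobiPoly_zero (b := b) ha)
    have hw := congrArg (aeval w) (X_mul_jacobiPoly_zero (b := b) ha)
    simp only [map_mul, map_add, aeval_X, aeval_C] at hz hw
    simp only [zero_add, Finset.sum_range_one]
    linear_combination aeval w (jacobiPoly a b 0) * hz - aeval z (jacobiPoly a b 0) * hw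
  | succ n ih =>
    have hz := congrArg (aeval z) (X_mul_jacobiPoly_succ (b := b) ha n)
    have hw := congrArg (aeval w) (X_mul_jacobiPoly_succ (b := b) ha n)
    simp only [map_mul, map_add, aeval_X, aeval_C] at hz hw
    rw [Finset.sum_range_succ, mul_add, ih]
    linear_combination aeval w (jacobiPoly a b (n + 1)) * hz
      - aeval z (jacobiPoly a b (n + 1)) * hw

/-- The diagonal Christoffel–Darboux kernel `∑_{k < n} p_k(x)²`. -/
noncomputable def christoffelKernel (a b : ℕ → ℝ) (n : ℕ) (x : ℝ) : ℝ :=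
  ∑ k ∈ Finset.range n, (jacobiPoly a b k).eval x ^ 2

lemma christoffelKernel_pos {n : ℕ} (hn : n ≠ 0) (x : ℝ) : 0 < christoffelKernel a b n x :=
  Finset.sum_pos' (fun _ _ => sq_nonneg _) ⟨0, by simpa using Nat.pos_of_ne_zero hn,
    by simp [jacobiPoly]⟩

lemma natDegree_jacobiPoly (ha : ∀ n, 1 ≤ n → 0 < a n) (n : ℕ) :
    (jacobiPoly a b n).natDegree = n := by
  suffices h : (jacobiPoly a b n).natDegree = n ∧ (jacobiPoly a b (n + 1)).natDegree = n + 1 from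
    h.1
  induction n with
  | zero =>
    refine ⟨by simp [jacobiPoly], ?_⟩
    rw [zero_add, jacobiPoly, natDegree_C_mul (inv_ne_zero (ha 1 le_rfl).ne'), natDegree_X_sub_C]
  | succ n ih =>
    refine ⟨ih.2, ?_⟩
    have h0 : jacobiPoly a b (n + 1) ≠ 0 := fun h => by simpa [h] using ih.2
    have h1 : ((X - C (b (n + 2))) * jacobiPoly a b (n + 1)).natDegree = n + 2 := by
      rw [natDegree_mul (X_sub_C_ne_zero _) h0, natDegree_X_sub_C, ih.2]; omega
    have h2 : (C (a (n + 1)) * jacobiPoly a b n).natDegree ≤ n :=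
      (natDegree_C_mul_le _ _).trans ih.1.le
    rw [jacobiPoly, natDegree_C_mul (inv_ne_zero (ha (n + 2) (by omega)).ne'),
      natDegree_sub_eq_left_of_natDegree_lt (by omega), h1]

lemma jacobiPoly_ne_zero (ha : ∀ n, 1 ≤ n → 0 < a n) (n : ℕ) : jacobiPoly a b n ≠ 0 := by
  rcases n with _ | n
  · simp [jacobiPoly]
  · exact fun h => by simpa [h] using natDegree_jacobiPoly (b := b) ha (n + 1)

/-- The span of the `p_n` contains `1` and is stable under multiplication by `X`. -/
lemma span_jacobiPoly (ha : ∀ n, 1 ≤ n → 0 < a n) :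
    Submodule.span ℝ (Set.range (jacobiPoly a b)) = ⊤ := by
  set V := Submodule.span ℝ (Set.range (jacobiPoly a b)) with hV
  have hmem : ∀ n, jacobiPoly a b n ∈ V := fun n => Submodule.subset_span ⟨n, rfl⟩
  have hX : ∀ q ∈ V, X * q ∈ V := by
    intro q hq
    induction hq using Submodule.span_induction with
    | mem q hq =>
      obtain ⟨n, rfl⟩ := hq
      rcases n with _ | n
      · rw [X_mul_jacobiPoly_zero ha]
        simp only [← smul_eq_C_mul]
        exact V.add_mem (V.smul_mem _ (hmem _)) (V.smul_mem _ (hmem _))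
      · rw [X_mul_jacobiPoly_succ ha]
        simp only [← smul_eq_C_mul]
        exact V.add_mem (V.add_mem (V.smul_mem _ (hmem _)) (V.smul_mem _ (hmem _)))
          (V.smul_mem _ (hmem _))
    | zero => simp
    | add p q _ _ hp hq => rw [mul_add]; exact V.add_mem hp hq
    | smul c q _ hq => rw [mul_smul_comm]; exact V.smul_mem _ hq
  have hpow : ∀ n : ℕ, (X : ℝ[X]) ^ n ∈ V := by
    intro n
    induction n with
    | zero => simpa [jacobiPoly] using hmem 0
    | succ n ih => rw [pow_succ']; exact hX _ ih
  rw [eq_top_iff]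
  intro q _
  rw [q.as_sum_range_C_mul_X_pow]
  refine V.sum_mem fun k _ => ?_
  rw [← smul_eq_C_mul]
  exact V.smul_mem _ (hpow k)

/-- Zeros are real: apply Christoffel–Darboux to `z` and its conjugate. -/
lemma conj_eq_of_aeval_jacobiPoly_eq_zero (ha : ∀ n, 1 ≤ n → 0 < a n) {n : ℕ} (hn : 1 ≤ n) {z : ℂ}
    (hz : aeval z (jacobiPoly a b n) = 0) : (starRingEnd ℂ) z = z := by
  obtain ⟨n, rfl⟩ : ∃ m, n = m + 1 := ⟨n - 1, by omega⟩
  have hconj : ∀ k, aeval ((starRingEnd ℂ) z) (jacobiPoly a b k)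
      = (starRingEnd ℂ) (aeval z (jacobiPoly a b k)) := fun k =>
    aeval_algHom_apply Complex.conjAe.toAlgHom z (jacobiPoly a b k)
  have h := christoffel_darboux (b := b) ha z ((starRingEnd ℂ) z) n
  simp only [hconj, hz, map_zero, mul_zero, zero_mul, sub_zero, Complex.mul_conj] at h
  rw [mul_eq_zero, sub_eq_zero] at h
  refine (h.resolve_right ?_).symm
  rw [← Complex.ofReal_sum, Complex.ofReal_eq_zero]
  exact (Finset.sum_pos' (fun _ _ => Complex.normSq_nonneg _) ⟨0, by simp, by
    simp [jacobiPoly]⟩).ne'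

lemma splits_jacobiPoly (ha : ∀ n, 1 ≤ n → 0 < a n) (n : ℕ) : (jacobiPoly a b n).Splits := by
  rcases n with _ | n
  · simp [jacobiPoly]
  refine Splits.of_splits_map (algebraMap ℝ ℂ) (IsAlgClosed.splits _) fun z hz => ?_
  rw [mem_roots', IsRoot, eval_map_algebraMap] at hz
  obtain ⟨x, hx⟩ := Complex.conj_eq_iff_real.1
    (conj_eq_of_aeval_jacobiPoly_eq_zero ha (by omega) hz.2)
  exact ⟨x, hx.symm⟩

/-- Zeros are simple: at a zero `y` of `p_{n+1}`, differentiating the Christoffel–Darboux identity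
gives `∑_{k ≤ n} p_k(y)² = a_{n+1} p_{n+1}'(y) p_n(y)`, and the left side is positive. -/
lemma nodup_roots_jacobiPoly (ha : ∀ n, 1 ≤ n → 0 < a n) (n : ℕ) :
    (jacobiPoly a b n).roots.Nodup := by
  rcases n with _ | n
  · simp [jacobiPoly]
  classical
  rw [Multiset.nodup_iff_count_le_one]
  intro y
  rw [count_roots]
  by_contra! h
  rw [one_lt_rootMultiplicity_iff_isRoot (jacobiPoly_ne_zero ha _)] at h
  have hC : ∀ k, aeval (C y) (jacobiPoly a b k) = C ((jacobiPoly a b k).eval y) := fun k => by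
    have := aeval_algebraMap_apply ℝ[X] y (jacobiPoly a b k)
    simpa [← algebraMap_eq] using this
  have hcd := congrArg (fun q => (derivative q).eval y)
    (christoffel_darboux (b := b) ha (X : ℝ[X]) (C y) n)
  simp only [hC, aeval_X_left_apply, h.1.eq_zero] at hcd
  simp only [derivative_mul, derivative_sub, derivative_X, derivative_C, algebraMap_eq, map_zero,
    eval_add, eval_mul, eval_sub, eval_X, eval_C, eval_finsetSum, h.2.eq_zero] at hcd
  simp only [sub_zero, eval_one, one_mul, sub_self, zero_mul, add_zero, mul_zero, eval_zero,
    ← pow_two] at hcd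
  exact (christoffelKernel_pos (a := a) (b := b) (Nat.succ_ne_zero n) y).ne' hcd

lemma card_roots_jacobiPoly (ha : ∀ n, 1 ≤ n → 0 < a n) (n : ℕ) :
    (jacobiPoly a b n).roots.toFinset.card = n := by
  rw [Multiset.toFinset_card_of_nodup (nodup_roots_jacobiPoly ha n),
    ← (splits_jacobiPoly ha n).natDegree_eq_card_roots, natDegree_jacobiPoly ha]

/-- Discrete orthonormality on the zeros of `p_n`, with the Christoffel weights `1 / K_n(x)`. By
Christoffel–Darboux the square matrix `p_k(x)`, with `k < n` and `x` a zero, has orthogonal columns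
of square length `K_n(x)`; a left inverse of a square matrix is a right inverse, so its rows are
orthonormal for the weights. -/
lemma sum_roots_jacobiPoly_mul (ha : ∀ n, 1 ≤ n → 0 < a n) {n k l : ℕ} (hk : k < n) (hl : l < n) :
    ∑ x ∈ (jacobiPoly a b n).roots.toFinset, (christoffelKernel a b n x)⁻¹ *
      ((jacobiPoly a b k).eval x * (jacobiPoly a b l).eval x) = if k = l then 1 else 0 := by
  obtain ⟨m, rfl⟩ : ∃ m, n = m + 1 := ⟨n - 1, by omega⟩
  set s := (jacobiPoly a b (m + 1)).roots.toFinset with hs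
  have hroot : ∀ x ∈ s, (jacobiPoly a b (m + 1)).eval x = 0 := fun x hx =>
    (mem_roots'.1 (Multiset.mem_toFinset.1 hx)).2
  let A : Matrix (Fin (m + 1)) s ℝ := fun k x => (jacobiPoly a b k).eval (x : ℝ)
  let B : Matrix s (Fin (m + 1)) ℝ := fun x k =>
    (christoffelKernel a b (m + 1) x)⁻¹ * (jacobiPoly a b k).eval (x : ℝ)
  have hBA : B * A = 1 := by
    ext x y
    rw [Matrix.mul_apply, Matrix.one_apply]
    simp only [A, B, mul_assoc]
    rw [← Finset.mul_sum,
      Fin.sum_univ_eq_sum_range (fun k => (jacobiPoly a b k).eval (x : ℝ) *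
        (jacobiPoly a b k).eval (y : ℝ))]
    split_ifs with hxy
    · subst hxy
      simp only [← pow_two]
      exact inv_mul_cancel₀ (christoffelKernel_pos (Nat.succ_ne_zero m) _).ne'
    · have hcd := christoffel_darboux (b := b) ha (x : ℝ) (y : ℝ) m
      simp only [coe_aeval_eq_eval, hroot _ x.2, hroot _ y.2, zero_mul, mul_zero, sub_zero,
        mul_eq_zero, sub_eq_zero, Subtype.coe_injective.eq_iff, hxy, false_or] at hcd
      rw [hcd, mul_zero]
  have hcard : Fintype.card s = Fintype.card (Fin (m + 1)) := by
    rw [Fintype.card_coe, card_roots_jacobiPoly ha, Fintype.card_fin]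
  have hAB : A * B = 1 :=
    (Matrix.mul_eq_one_comm_of_equiv (Fintype.equivOfCardEq hcard)).1 hBA
  have h := congrFun (congrFun hAB ⟨k, hk⟩) ⟨l, hl⟩
  rw [Matrix.mul_apply, Matrix.one_apply] at h
  simp only [A, B, Fin.mk.injEq] at h
  rw [← h, ← Finset.sum_coe_sort s]
  exact Finset.sum_congr rfl fun x _ => by ring

/-- If `|x| ≥ B + 2A`, the recurrence makes `|p_n(x)|` nondecreasing in `n`, so that `x` is not a
zero. -/
lemma abs_lt_of_eval_jacobiPoly_eq_zero (ha : ∀ n, 1 ≤ n → 0 < a n) {A B : ℝ}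
    (hA : ∀ n, 1 ≤ n → a n ≤ A) (hB : ∀ n, 1 ≤ n → |b n| ≤ B) {n : ℕ} {x : ℝ}
    (hx : (jacobiPoly a b n).eval x = 0) : |x| < B + 2 * A := by
  by_contra! hx'
  have hA0 : 0 < A := (ha 1 le_rfl).trans_le (hA 1 le_rfl)
  have hstep : ∀ k, 1 ≤ k → ∀ u v : ℝ, A * |u| ≤ a k * |v| → |u| ≤ |v| := fun k hk u v h =>
    le_of_mul_le_mul_left (h.trans (mul_le_mul_of_nonneg_right (hA k hk) (abs_nonneg v))) hA0
  have hxb : ∀ k, 1 ≤ k → 2 * A ≤ |x - b k| := fun k hk => by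
    have := abs_sub_abs_le_abs_sub x (b k)
    linarith [hB k hk]
  have hmono : ∀ k, |(jacobiPoly a b k).eval x| ≤ |(jacobiPoly a b (k + 1)).eval x| := by
    intro k
    induction k with
    | zero =>
      refine hstep 1 le_rfl _ _ ?_
      have h := congrArg (eval x) (X_mul_jacobiPoly_zero (b := b) ha)
      simp only [eval_mul, eval_add, eval_X, eval_C] at h
      rw [zero_add, ← abs_of_pos (ha 1 le_rfl), ← abs_mul,
        show a 1 * (jacobiPoly a b 1).eval x = (x - b 1) * (jacobiPoly a b 0).eval x by
          linear_combination -h, abs_mul]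
      exact mul_le_mul_of_nonneg_right (by linarith [hxb 1 le_rfl]) (abs_nonneg _)
    | succ k ih =>
      refine hstep (k + 2) (by omega) _ _ ?_
      have h := congrArg (eval x) (X_mul_jacobiPoly_succ (b := b) ha k)
      simp only [eval_mul, eval_add, eval_X, eval_C] at h
      have h1 : a (k + 2) * |(jacobiPoly a b (k + 2)).eval x| =
          |(x - b (k + 2)) * (jacobiPoly a b (k + 1)).eval x
            - a (k + 1) * (jacobiPoly a b k).eval x| := by
        nth_rw 1 [← abs_of_pos (ha (k + 2) (by omega))]
        rw [← abs_mul]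
        congr 1
        linear_combination -h
      have h2 := abs_sub_abs_le_abs_sub ((x - b (k + 2)) * (jacobiPoly a b (k + 1)).eval x)
        (a (k + 1) * (jacobiPoly a b k).eval x)
      rw [abs_mul, abs_mul, abs_of_pos (ha (k + 1) (by omega))] at h2
      have h3 := mul_le_mul_of_nonneg_right (hxb (k + 2) (by omega))
        (abs_nonneg ((jacobiPoly a b (k + 1)).eval x))
      have h4 := mul_le_mul (hA (k + 1) (by omega)) ih (abs_nonneg _) hA0.le
      rw [h1]
      linarith
  have h0 := monotone_nat_of_le_succ hmono (Nat.zero_le n)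
  simp only [hx, abs_zero] at h0
  simp [jacobiPoly] at h0
  linarith

end JacobiPoly

/-! ### Quadrature and estimates for the spectral measure -/

namespace IsSpectralMeasure

variable {a b : ℕ → ℝ} {μ : Measure ℝ}

lemma integrable_eval (hμ : IsSpectralMeasure a b μ) (ha : ∀ n, 1 ≤ n → 0 < a n) (q : ℝ[X]) :
    Integrable (fun x => q.eval x) μ := by
  have hq : q ∈ Submodule.span ℝ (Set.range (jacobiPoly a b)) := by simp [span_jacobiPoly ha]
  induction hq using Submodule.span_induction with
  | mem q hq =>
    obtain ⟨n, rfl⟩ := hq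
    simpa [jacobiPoly] using hμ.integrable n 0
  | zero => simp
  | add p q _ _ hp hq => simp only [eval_add]; exact hp.add hq
  | smul c q _ hq => simpa using hq.const_mul c

/-- Gauss quadrature, in the form needed here: for every polynomial it is exact for all large
`n`. -/
lemma eventually_integral_eq_sum_roots (hμ : IsSpectralMeasure a b μ)
    (ha : ∀ n, 1 ≤ n → 0 < a n) (q : ℝ[X]) :
    ∀ᶠ n in atTop, ∫ x, q.eval x ∂μ =
      ∑ x ∈ (jacobiPoly a b n).roots.toFinset, (christoffelKernel a b n x)⁻¹ * q.eval x := by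
  have hq : q ∈ Submodule.span ℝ (Set.range (jacobiPoly a b)) := by simp [span_jacobiPoly ha]
  induction hq using Submodule.span_induction with
  | mem q hq =>
    obtain ⟨k, rfl⟩ := hq
    filter_upwards [eventually_gt_atTop k] with n hn
    have h1 := hμ.orthonormal k 0
    have h2 := sum_roots_jacobiPoly_mul (b := b) ha hn (Nat.zero_lt_of_lt hn)
    rw [← h2] at h1
    simpa [jacobiPoly] using h1
  | zero => simp
  | add p q _ _ hp hq =>
    filter_upwards [hp, hq] with n h1 h2
    simp only [eval_add, mul_add, Finset.sum_add_distrib]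
    rw [integral_add (hμ.integrable_eval ha p) (hμ.integrable_eval ha q), h1, h2]
  | smul c q _ hq =>
    filter_upwards [hq] with n h1
    simp only [eval_smul, smul_eq_mul, mul_left_comm _ c]
    rw [integral_const_mul, h1, Finset.mul_sum]

lemma integral_sum_sq (hμ : IsSpectralMeasure a b μ) (s : Finset ℕ) (c : ℕ → ℝ) :
    ∫ x, (∑ k ∈ s, c k * (jacobiPoly a b k).eval x) ^ 2 ∂μ = ∑ k ∈ s, c k ^ 2 := by
  have h : ∀ x, (∑ k ∈ s, c k * (jacobiPoly a b k).eval x) ^ 2 = ∑ k ∈ s, ∑ l ∈ s,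
      c k * c l * ((jacobiPoly a b k).eval x * (jacobiPoly a b l).eval x) := fun x => by
    rw [pow_two, Finset.sum_mul_sum]
    exact Finset.sum_congr rfl fun k _ => Finset.sum_congr rfl fun l _ => by ring
  simp only [h]
  rw [integral_finsetSum _ fun k _ => integrable_finsetSum _ fun l _ =>
    (hμ.integrable k l).const_mul _]
  refine Finset.sum_congr rfl fun k hk => ?_
  rw [integral_finsetSum _ fun l _ => (hμ.integrable k l).const_mul _]
  simp only [integral_const_mul, hμ.orthonormal, mul_ite, mul_one, mul_zero, Finset.sum_ite_eq, hk,
    if_true, pow_two]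

/-- Integrate `d² K(x, y)² ≤ (x - y)² K(x, y)²` in `x`, where `K(x, y) = ∑_{k ≤ n} p_k(x) p_k(y)`,
and compute the right side by Christoffel–Darboux. -/
lemma sq_mul_christoffelKernel_le (hμ : IsSpectralMeasure a b μ) (ha : ∀ n, 1 ≤ n → 0 < a n)
    {d y : ℝ} (hd : 0 ≤ d) (hy : ∀ᵐ x ∂μ, d ≤ |x - y|) (n : ℕ) :
    d ^ 2 * christoffelKernel a b (n + 1) y ≤ a (n + 1) ^ 2 *
      ((jacobiPoly a b n).eval y ^ 2 + (jacobiPoly a b (n + 1)).eval y ^ 2) := by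
  set c : ℕ → ℝ := fun k => (jacobiPoly a b k).eval y with hc
  set e : ℕ → ℝ := fun k => if k = n then -(a (n + 1) * c (n + 1)) else a (n + 1) * c n with he
  have hcd : ∀ x, (x - y) * ∑ k ∈ Finset.range (n + 1), c k * (jacobiPoly a b k).eval x =
      ∑ k ∈ {n, n + 1}, e k * (jacobiPoly a b k).eval x := fun x => by
    have := christoffel_darboux (b := b) ha x y n
    simp only [coe_aeval_eq_eval, mul_comm _ (eval y _), Algebra.algebraMap_self, RingHom.id_apply]
      at this
    rw [this, Finset.sum_pair (by omega)]
    simp only [he, hc, if_true, Nat.succ_ne_self, if_false]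
    ring
  have hint : ∀ (s : Finset ℕ) (c : ℕ → ℝ),
      Integrable (fun x => (∑ k ∈ s, c k * (jacobiPoly a b k).eval x) ^ 2) μ := fun s c => by
    have := hμ.integrable_eval ha ((∑ k ∈ s, C (c k) * jacobiPoly a b k) ^ 2)
    simpa [eval_finsetSum] using this
  have h1 : ∫ x, d ^ 2 * (∑ k ∈ Finset.range (n + 1), c k * (jacobiPoly a b k).eval x) ^ 2 ∂μ ≤
      ∫ x, (∑ k ∈ {n, n + 1}, e k * (jacobiPoly a b k).eval x) ^ 2 ∂μ := by
    refine integral_mono_ae ((hint _ _).const_mul _) (hint _ _) ?_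
    filter_upwards [hy] with x hx
    rw [← hcd, mul_pow]
    have : d ^ 2 ≤ (x - y) ^ 2 := by
      rw [← sq_abs (x - y)]
      exact pow_le_pow_left₀ hd hx 2
    exact mul_le_mul_of_nonneg_right this (sq_nonneg _)
  rw [integral_const_mul, hμ.integral_sum_sq, hμ.integral_sum_sq, Finset.sum_pair (by omega)] at h1
  simp only [he, if_true, Nat.succ_ne_self, if_false] at h1
  calc d ^ 2 * christoffelKernel a b (n + 1) y ≤ _ := h1
    _ = _ := by simp only [hc]; ring

/-- Zeros of consecutive orthogonal polynomials, both at distance at least `d` from almost every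
point, cannot be closer to each other than `d² / a_{n+1}`. -/
lemma sq_le_abs_sub_mul (hμ : IsSpectralMeasure a b μ) (ha : ∀ n, 1 ≤ n → 0 < a n)
    {d y w : ℝ} (hd : 0 ≤ d) (hy : ∀ᵐ x ∂μ, d ≤ |x - y|) (hw : ∀ᵐ x ∂μ, d ≤ |x - w|) {n : ℕ}
    (hy0 : (jacobiPoly a b n).eval y = 0) (hw0 : (jacobiPoly a b (n + 1)).eval w = 0) :
    d ^ 2 ≤ |y - w| * a (n + 1) := by
  have han := ha (n + 1) (by omega)
  have h1 := hμ.sq_mul_christoffelKernel_le ha hd hy n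
  have h2 := hμ.sq_mul_christoffelKernel_le ha hd hw n
  have hcd := christoffel_darboux (b := b) ha y w n
  have hcs := Finset.sum_mul_sq_le_sq_mul_sq (Finset.range (n + 1))
    (fun k => (jacobiPoly a b k).eval y) (fun k => (jacobiPoly a b k).eval w)
  have hKy := christoffelKernel_pos (a := a) (b := b) (Nat.succ_ne_zero n) y
  have hKw := christoffelKernel_pos (a := a) (b := b) (Nat.succ_ne_zero n) w
  change _ ≤ christoffelKernel a b (n + 1) y * christoffelKernel a b (n + 1) w at hcs
  simp only [coe_aeval_eq_eval, Algebra.algebraMap_self, RingHom.id_apply, hy0, hw0, zero_mul,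
    sub_zero] at hcd
  rw [hy0] at h1
  rw [hw0] at h2
  set Ky := christoffelKernel a b (n + 1) y
  set Kw := christoffelKernel a b (n + 1) w
  set T := ∑ k ∈ Finset.range (n + 1), (jacobiPoly a b k).eval y * (jacobiPoly a b k).eval w
  have h3 := mul_le_mul h1 h2 (by positivity) (by positivity)
  have h4 : (d ^ 2) ^ 2 * (Ky * Kw) ≤ (|y - w| * a (n + 1)) ^ 2 * (Ky * Kw) :=
    calc (d ^ 2) ^ 2 * (Ky * Kw) = d ^ 2 * Ky * (d ^ 2 * Kw) := by ring
      _ ≤ _ := h3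
      _ = a (n + 1) ^ 2 * ((y - w) * T) ^ 2 := by rw [hcd]; ring
      _ = (|y - w| * a (n + 1)) ^ 2 * T ^ 2 := by rw [mul_pow, mul_pow, sq_abs]; ring
      _ ≤ _ := mul_le_mul_of_nonneg_left hcs (sq_nonneg _)
  exact le_of_sq_le_sq (le_of_mul_le_mul_right h4 (by positivity)) (by positivity)

/-- Each even moment is a Gauss average of values at zeros, so it is at most `M ^ (2k)`; by Markov's
inequality the mass outside `[-(M + 1), M + 1]` is at most `(M / (M + 1)) ^ (2k)` for every `k`. -/
lemma ae_abs_le (hμ : IsSpectralMeasure a b μ) (ha : ∀ n, 1 ≤ n → 0 < a n) {M : ℝ} (hM : 0 ≤ M)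
    (hroots : ∀ n x, (jacobiPoly a b n).eval x = 0 → |x| ≤ M) : ∀ᵐ x ∂μ, |x| ≤ M + 1 := by
  have := hμ.isProbabilityMeasure
  have hmoment : ∀ k : ℕ, ∫ x, (x ^ 2) ^ k ∂μ ≤ (M ^ 2) ^ k := by
    intro k
    obtain ⟨n, h1, h2⟩ := ((hμ.eventually_integral_eq_sum_roots ha ((X ^ 2) ^ k)).and
      (hμ.eventually_integral_eq_sum_roots ha 1)).exists
    simp only [eval_pow, eval_X, eval_one, mul_one, integral_const, probReal_univ, smul_eq_mul]
      at h1 h2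
    rw [h1, ← one_mul ((M ^ 2) ^ k), h2, Finset.sum_mul]
    refine Finset.sum_le_sum fun x hx => mul_le_mul_of_nonneg_left ?_
      (inv_nonneg.2 (Finset.sum_nonneg fun _ _ => sq_nonneg _))
    have hx := hroots n x (mem_roots'.1 (Multiset.mem_toFinset.1 hx)).2
    rw [← sq_abs x]
    exact pow_le_pow_left₀ (sq_nonneg _) (pow_le_pow_left₀ (abs_nonneg _) hx 2) k
  set s : Set ℝ := {x | ((M + 1) ^ 2) ≤ x ^ 2} with hs
  have hmarkov : ∀ k : ℕ, μ.real s ≤ (M ^ 2 / (M + 1) ^ 2) ^ k := by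
    intro k
    have hint : Integrable (fun x : ℝ => (x ^ 2) ^ k) μ := by
      have := hμ.integrable_eval ha ((X ^ 2) ^ k)
      simpa only [eval_pow, eval_X] using this
    have h := mul_meas_ge_le_integral_of_nonneg
      (ae_of_all μ fun x : ℝ => show (0 : ℝ) ≤ (x ^ 2) ^ k by positivity) hint
      (((M + 1) ^ 2) ^ k)
    have hsub : μ.real s ≤ μ.real {x | ((M + 1) ^ 2) ^ k ≤ (x ^ 2) ^ k} :=
      measureReal_mono fun x (hx : (M + 1) ^ 2 ≤ x ^ 2) =>
        pow_le_pow_left₀ (sq_nonneg (M + 1)) hx k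
    rw [div_pow, le_div_iff₀ (by positivity), mul_comm]
    exact (mul_le_mul_of_nonneg_left hsub (by positivity)).trans (h.trans (hmoment k))
  have hlim : Tendsto (fun k : ℕ => (M ^ 2 / (M + 1) ^ 2) ^ k) atTop (𝓝 0) :=
    tendsto_pow_atTop_nhds_zero_of_lt_one (by positivity)
      ((div_lt_one (by positivity)).2 (pow_lt_pow_left₀ (by linarith) hM two_ne_zero))
  have hzero : μ.real s = 0 :=
    le_antisymm (ge_of_tendsto' hlim hmarkov) measureReal_nonneg
  rw [measureReal_eq_zero_iff] at hzero
  filter_upwards [measure_eq_zero_iff_ae_notMem.1 hzero] with x hx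
  simp only [hs, Set.mem_ofPred_eq, not_le] at hx
  exact (abs_lt_of_sq_lt_sq hx (by linarith)).le

/-- Near a point of the support there is a zero of `p_n` for all large `n`. With
`h(x) = ε² - (x - x₀)²`, some polynomial `q` has `∫ h q² > 0`: take `q` close to `max 0 h` on an
interval carrying `μ`. Gauss quadrature then forces `h > 0` at some zero of `p_n`. -/
lemma eventually_exists_root (hμ : IsSpectralMeasure a b μ) (ha : ∀ n, 1 ≤ n → 0 < a n) {D : ℝ}
    (hD : ∀ᵐ x ∂μ, |x| ≤ D) {x₀ : ℝ} (hx₀ : x₀ ∈ μ.support) {ε : ℝ} (hε : 0 < ε) :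
    ∀ᶠ n in atTop, ∃ x, (jacobiPoly a b n).eval x = 0 ∧ |x - x₀| < ε := by
  have := hμ.isProbabilityMeasure
  set h : ℝ → ℝ := fun x => ε ^ 2 - (x - x₀) ^ 2 with hh
  set f : ℝ → ℝ := fun x => max 0 (h x) with hf
  have hcont : Continuous h := by fun_prop
  have hfcont : Continuous f := continuous_const.max hcont
  have hf0 : ∀ x, 0 ≤ f x := fun x => le_max_left _ _
  have hf1 : ∀ x, f x ≤ ε ^ 2 := fun x =>
    max_le (sq_nonneg _) (sub_le_self _ (sq_nonneg _))
  have hcube : ∀ x, h x * f x ^ 2 = f x ^ 3 := fun x => by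
    rcases le_total (h x) 0 with hx | hx
    · simp [hf, max_eq_left hx]
    · simp only [hf, max_eq_right hx]; ring
  have hcubeint : Integrable (fun x => f x ^ 3) μ :=
    Integrable.of_bound (by fun_prop : Continuous fun x => f x ^ 3).aestronglyMeasurable
      ((ε ^ 2) ^ 3) (ae_of_all _ fun x => by
        rw [Real.norm_of_nonneg (pow_nonneg (hf0 x) 3)]
        exact pow_le_pow_left₀ (hf0 x) (hf1 x) 3)
  have hpos : 0 < ∫ x, f x ^ 3 ∂μ := by
    rw [integral_pos_iff_support_of_nonneg (fun x => pow_nonneg (hf0 x) 3) hcubeint]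
    refine (Measure.mem_support_iff_forall x₀).1 hx₀ _ ?_
    filter_upwards [hcont.continuousAt.eventually_const_lt
      (show 0 < h x₀ by simp [hh]; positivity)] with x hx
    exact (pow_pos (lt_max_of_lt_right hx) 3).ne'
  obtain ⟨H, hH⟩ := (isCompact_Icc (a := -D) (b := D)).exists_bound_of_continuousOn
    hcont.continuousOn
  obtain ⟨η, hη0, hη1, hη⟩ : ∃ η > 0, η ≤ 1 ∧
      |H| * (η * (2 * ε ^ 2 + 1)) < ∫ x, f x ^ 3 ∂μ := by
    have hlim : Tendsto (fun η : ℝ => |H| * (η * (2 * ε ^ 2 + 1))) (𝓝[>] 0) (𝓝 0) := by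
      have : Continuous fun η : ℝ => |H| * (η * (2 * ε ^ 2 + 1)) := by fun_prop
      simpa using (this.tendsto 0).mono_left nhdsWithin_le_nhds
    obtain ⟨η, ⟨h1, h2⟩, h3⟩ := (((hlim.eventually_lt_const hpos).and
      (nhdsWithin_le_nhds (Iic_mem_nhds one_pos))).and self_mem_nhdsWithin).exists
    exact ⟨η, h3, h2, h1⟩
  obtain ⟨q, hq⟩ := exists_polynomial_near_of_continuousOn (-D) D f hfcont.continuousOn η hη0
  set Q : ℝ[X] := (C (ε ^ 2) - (X - C x₀) ^ 2) * q ^ 2 with hQ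
  have hQeval : ∀ x, Q.eval x = h x * q.eval x ^ 2 := fun x => by simp [hQ, hh]
  have hQpos : 0 < ∫ x, Q.eval x ∂μ := by
    have hle : ∫ x, (f x ^ 3 - |H| * (η * (2 * ε ^ 2 + 1))) ∂μ ≤ ∫ x, Q.eval x ∂μ := by
      refine integral_mono_ae (hcubeint.sub (integrable_const _)) (hμ.integrable_eval ha Q) ?_
      filter_upwards [hD] with x hx
      have hx := abs_le.1 hx
      have hqx := (hq x hx).le
      have hHx : |h x| ≤ |H| := (hH x hx).trans (le_abs_self H)
      have hsum : |q.eval x + f x| ≤ 2 * ε ^ 2 + 1 := by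
        have := abs_le.1 hqx
        rw [abs_le]
        constructor <;> linarith [hf0 x, hf1 x, sq_nonneg ε]
      have hdiff : |h x * (q.eval x ^ 2 - f x ^ 2)| ≤ |H| * (η * (2 * ε ^ 2 + 1)) := by
        rw [sq_sub_sq, mul_comm (q.eval x + f x), abs_mul, abs_mul]
        exact mul_le_mul hHx (mul_le_mul hqx hsum (abs_nonneg _) hη0.le) (by positivity)
          (abs_nonneg _)
      change f x ^ 3 - _ ≤ Q.eval x
      rw [hQeval, ← hcube]
      linarith [(abs_le.1 hdiff).1]
    rw [integral_sub hcubeint (integrable_const _), integral_const, probReal_univ, one_smul] at hle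
    linarith
  filter_upwards [hμ.eventually_integral_eq_sum_roots ha Q] with n hn
  rw [hn] at hQpos
  obtain ⟨x, hx, hxpos⟩ := Finset.exists_lt_of_sum_lt (f := fun _ => (0 : ℝ)) (by simpa using hQpos)
  refine ⟨x, (mem_roots'.1 (Multiset.mem_toFinset.1 hx)).2, ?_⟩
  have hK : 0 ≤ (christoffelKernel a b n x)⁻¹ :=
    inv_nonneg.2 (Finset.sum_nonneg fun _ _ => sq_nonneg _)
  have hhx : 0 < h x := by
    by_contra! hneg
    rw [hQeval] at hxpos
    exact hxpos.not_ge (mul_nonpos_of_nonneg_of_nonpos hK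
      (mul_nonpos_of_nonpos_of_nonneg hneg (sq_nonneg _)))
  exact abs_lt_of_sq_lt_sq (sub_pos.1 hhx) hε.le

end IsSpectralMeasure

/-! ### Periodic parameters -/

lemma exists_abs_le_of_periodic {u : ℕ → ℝ} {p : ℕ} (hp : 1 ≤ p)
    (hu : ∀ n, 1 ≤ n → u (n + p) = u n) : ∃ A, ∀ n, 1 ≤ n → |u n| ≤ A := by
  refine ⟨∑ k ∈ Finset.range (p + 1), |u k|, fun n => ?_⟩
  induction n using Nat.strong_induction_on with
  | _ n ih =>
    intro hn
    by_cases h : n < p + 1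
    · exact Finset.single_le_sum (f := fun k => |u k|) (fun _ _ => abs_nonneg _)
        (Finset.mem_range.2 h)
    · have := hu (n - p) (by omega)
      rw [Nat.sub_add_cancel (by omega)] at this
      rw [this]
      exact ih (n - p) (by omega) (by omega)

theorem proposition2p6 (a b : ℕ → ℝ) (p : ℕ) (hp : 1 ≤ p)
    (ha_pos : ∀ n, 1 ≤ n → 0 < a n)
    (ha : ∀ n, 1 ≤ n → a (n + p) = a n) (hb : ∀ n, 1 ≤ n → b (n + p) = b n)
    (μ : Measure ℝ) (hμ : IsSpectralMeasure a b μ) (z₀ : ℂ) :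
    IsLimitOfZeros (jacobiPoly a b) z₀ ↔ z₀ ∈ Complex.ofReal '' μ.support := by
  obtain ⟨A, hA⟩ := exists_abs_le_of_periodic hp ha
  obtain ⟨B, hB⟩ := exists_abs_le_of_periodic hp hb
  have hA' : ∀ n, 1 ≤ n → a n ≤ A := fun n hn => (le_abs_self _).trans (hA n hn)
  have hA0 : 0 < A := (ha_pos 1 le_rfl).trans_le (hA' 1 le_rfl)
  have hB0 : 0 ≤ B := (abs_nonneg _).trans (hB 1 le_rfl)
  constructor
  · rintro ⟨z, hz, hlim⟩
    have hreal : ∀ n, 1 ≤ n → ((z n).re : ℂ) = z n := fun n hn =>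
      Complex.conj_eq_iff_re.1 (conj_eq_of_aeval_jacobiPoly_eq_zero ha_pos hn (hz n hn))
    have hroot : ∀ n, 1 ≤ n → (jacobiPoly a b n).eval (z n).re = 0 := fun n hn => by
      have := hz n hn
      rw [← hreal n hn, ← Complex.coe_algebraMap, aeval_algebraMap_apply] at this
      simpa using this
    have hz₀ : (z₀.re : ℂ) = z₀ :=
      tendsto_nhds_unique (((Complex.continuous_ofReal.comp Complex.continuous_re).tendsto z₀).comp
        hlim) (hlim.congr' (by
          filter_upwards [eventually_ge_atTop 1] with n hn using (hreal n hn).symm))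
    have hre : Tendsto (fun n => (z n).re) atTop (𝓝 z₀.re) :=
      (Complex.continuous_re.tendsto z₀).comp hlim
    refine ⟨z₀.re, ?_, hz₀⟩
    by_contra hsupp
    obtain ⟨U, hU, hU0⟩ := Measure.notMem_support_iff_exists.1 hsupp
    obtain ⟨d, hd, hball⟩ := Metric.mem_nhds_iff.1 hU
    -- A zero within `d / 2` of `z₀` is at distance at least `d / 2` from almost every point.
    have hfar : ∀ y : ℝ, |y - z₀.re| < d / 2 → ∀ᵐ x ∂μ, d / 2 ≤ |x - y| := fun y hy => by
      filter_upwards [measure_eq_zero_iff_ae_notMem.1 hU0] with x hx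
      by_contra! hxy
      refine hx (hball ?_)
      rw [Metric.mem_ball, Real.dist_eq]
      linarith [abs_sub_le x y z₀.re]
    have hre' : Tendsto (fun n => (z (n + 1)).re) atTop (𝓝 z₀.re) :=
      (tendsto_add_atTop_iff_nat 1).2 hre
    have hnear : ∀ {u : ℕ → ℝ}, Tendsto u atTop (𝓝 z₀.re) →
        ∀ᶠ n in atTop, |u n - z₀.re| < d / 2 := fun hu => by
      filter_upwards [Metric.tendsto_nhds.1 hu (d / 2) (by positivity)] with n hn
      rwa [Real.dist_eq] at hn
    have hdiff : Tendsto (fun n => |(z n).re - (z (n + 1)).re| * A) atTop (𝓝 0) := by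
      simpa using (hre.sub hre').abs.mul_const A
    obtain ⟨n, ⟨⟨h1, h2⟩, h3⟩, hn⟩ := ((((hnear hre).and (hnear hre')).and
      (hdiff.eventually_lt_const (show 0 < (d / 2) ^ 2 by positivity))).and
      (eventually_ge_atTop 1)).exists
    have h4 := hμ.sq_le_abs_sub_mul ha_pos (by positivity) (hfar _ h1) (hfar _ h2) (hroot n hn)
      (hroot (n + 1) (by omega))
    have h5 := mul_le_mul_of_nonneg_left (hA' (n + 1) (by omega))
      (abs_nonneg ((z n).re - (z (n + 1)).re))
    linarith
  · rintro ⟨x₀, hx₀, rfl⟩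
    have hD := hμ.ae_abs_le ha_pos (M := B + 2 * A) (by positivity) fun n x hx =>
      (abs_lt_of_eval_jacobiPoly_eq_zero ha_pos hA' hB hx).le
    -- Take for `z_n` a zero of `p_n` closest to `x₀`.
    have hclosest : ∀ n : ℕ, ∃ y : ℝ, 1 ≤ n → (jacobiPoly a b n).eval y = 0 ∧
        ∀ x, (jacobiPoly a b n).eval x = 0 → |y - x₀| ≤ |x - x₀| := by
      intro n
      by_cases hn : 1 ≤ n
      · obtain ⟨y, hy, hmin⟩ := Finset.exists_min_image (jacobiPoly a b n).roots.toFinset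
          (fun x => |x - x₀|) (Finset.card_pos.1 (by rw [card_roots_jacobiPoly ha_pos]; omega))
        refine ⟨y, fun _ => ⟨(mem_roots'.1 (Multiset.mem_toFinset.1 hy)).2, fun x hx => hmin x ?_⟩⟩
        exact Multiset.mem_toFinset.2 (mem_roots'.2 ⟨jacobiPoly_ne_zero ha_pos n, hx⟩)
      · exact ⟨0, fun h => absurd h hn⟩
    choose y hy using hclosest
    refine ⟨fun n => (y n : ℂ), fun n hn => ?_,
      (Complex.continuous_ofReal.tendsto x₀).comp (Metric.tendsto_nhds.2 fun ε hε => ?_)⟩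
    · have := aeval_algebraMap_apply ℂ (y n) (jacobiPoly a b n)
      rw [Complex.coe_algebraMap, coe_aeval_eq_eval, (hy n hn).1] at this
      simpa using this
    · filter_upwards [hμ.eventually_exists_root ha_pos hD hx₀ hε, eventually_ge_atTop 1]
        with n ⟨x, hx, hxε⟩ hn
      rw [Real.dist_eq]
      exact ((hy n hn).2 x hx).trans_lt hxε
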